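/- Let $m\ge 1$ be an integer, $I=[0,1]$, and let $\mathcal U^m$ be the uniform distribution on $I^m$ (so the valuations $x_1,\dots,x_m$ of the $m$ goods are i.i.d. uniform on $I$). A selling mechanism is a pair of an allocation function $a:I^m\to I^m$ and a payment function $p:I^m\to[0,\infty)$. It is individually rational if $a(x)\cdot x-p(x)\ge 0$ for all $x\in I^m$, and incentive compatible if $a(x)\cdot x-p(x)\ge a(x')\cdot x-p(x')$ for all $x,x'\in I^m$. A feasible utility function on $I^m$ is a nonnegative convex function $u:I^m\to\mathbb R$ with $0\le \partial u/\partial x_j\le 1$ a.e. on $I^m$ for every $j$; its expected revenue is $R(u;\mathcal U^m)=\int_{I^m}\bigl(\nabla u(x)\cdot x-u(x)\bigr)\,dx$. Let $\mathrm{Rev}(\mathcal U^m)=\sup_u R(u;\mathcal U^m)$ be the optimal revenue, the supremum being over all feasible utility functions, and let $\mathrm{SRev}(\mathcal U^m)=\sum_{j=1}^m \mathrm{Rev}(\mathcal U^1)$ be the optimal revenue from selling the goods separately. **Theorem.** The optimal revenue from selling $m$ goods with i.i.d. uniform $[0,1]$ valuations satisfies $$\mathrm{Rev}(\mathcal U^m)\le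 \frac{m(1+m^2)}{2(1+m)^2}.$$ More precisely, for every feasible utility function $u$ the integrand of $R(u;\mathcal U^m)$ is integrable and $R(u;\mathcal U^m)$ is at most this bound, and for every individually rational and incentive compatible mechanism $(a,p)$ the payment $p$ is integrable and $\int_{I^m}p(x)\,dx$ is at most this bound. Moreover $\mathrm{SRev}(\mathcal U^m)=\frac m4$ and $$\frac{\mathrm{Rev}(\mathcal U^m)}{\mathrm{SRev}(\mathcal U^m)}\le \frac{2(1+m^2)}{(1+m)^2}<2 .$$ -/

import Mathlib

open MeasureTheory Set

noncomputable section

namespace GoodsMonopoly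

/-- A direct-revelation (randomized) selling mechanism for `m` goods, where the valuations lie in
the box `D = ∏ⱼ [Lⱼ, Hⱼ]`: an allocation function `D → [0,1]^m` and a payment function
`D → [0,∞)`.  (Only the values on the box `Set.Icc L H` matter.) -/
structure Mechanism {m : ℕ} (L H : Fin m → ℝ) where
  alloc : (Fin m → ℝ) → Fin m → ℝ
  pay : (Fin m → ℝ) → ℝ
  alloc_mem : ∀ x ∈ Icc L H, ∀ j, alloc x j ∈ Icc (0 : ℝ) 1
  pay_nonneg : ∀ x ∈ Icc L H, 0 ≤ pay x

namespace Mechanism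

variable {m : ℕ} {L H : Fin m → ℝ}

/-- Utility `u(x' | x)` of an additive buyer with true valuations `x` who reports `x'`. -/
def utility (M : Mechanism L H) (x' x : Fin m → ℝ) : ℝ :=
  ∑ j, M.alloc x' j * x j - M.pay x'

def IndividuallyRational (M : Mechanism L H) : Prop :=
  ∀ x ∈ Icc L H, 0 ≤ M.utility x x

def IncentiveCompatible (M : Mechanism L H) : Prop :=
  ∀ x ∈ Icc L H, ∀ x' ∈ Icc L H, M.utility x' x ≤ M.utility x x

/-- Expected payment when the valuations are independent with `xⱼ ∼ F j`. -/
def expectedPayment (M : Mechanism L H) (F : Fin m → Measure ℝ) : ℝ :=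
  ∫ x in Icc L H, M.pay x ∂(Measure.pi F)

end Mechanism

/-- The partial derivative `∂u/∂xⱼ` at `x`. -/
def partialDeriv {m : ℕ} (u : (Fin m → ℝ) → ℝ) (j : Fin m) (x : Fin m → ℝ) : ℝ :=
  lineDeriv ℝ u x (Pi.single j 1)

/-- The feasible utility functions on the box `D = ∏ⱼ [Lⱼ, Hⱼ]`: nonnegative convex functions on
`D` with `0 ≤ ∂u/∂xⱼ ≤ 1` almost everywhere in `D`, for every good `j`. -/
structure IsFeasibleUtility {m : ℕ} (L H : Fin m → ℝ) (u : (Fin m → ℝ) → ℝ) : Prop where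
  nonneg : ∀ x ∈ Icc L H, 0 ≤ u x
  convex : ConvexOn ℝ (Icc L H) u
  deriv_mem : ∀ j, ∀ᵐ x ∂(volume.restrict (Icc L H)), partialDeriv u j x ∈ Icc (0 : ℝ) 1

/-- The payment `∇u(x) · x - u(x)` of the mechanism that induces the utility function `u`. -/
def inducedPayment {m : ℕ} (u : (Fin m → ℝ) → ℝ) (x : Fin m → ℝ) : ℝ :=
  ∑ j, partialDeriv u j x * x j - u x

/-- The expected revenue `R(u; F) = ∫_D (∇u(x) · x - u(x)) dF(x)` for the product distribution
`F = F₁ × ⋯ × Fₘ` on the box `D`. -/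
def expectedRevenue {m : ℕ} (L H : Fin m → ℝ) (F : Fin m → Measure ℝ)
    (u : (Fin m → ℝ) → ℝ) : ℝ :=
  ∫ x in Icc L H, inducedPayment u x ∂(Measure.pi F)

/-- The optimal revenue `Rev(F) = sup_u R(u; F)` over the feasible utility functions. -/
def Rev {m : ℕ} (L H : Fin m → ℝ) (F : Fin m → Measure ℝ) : ℝ :=
  sSup {r | ∃ u, IsFeasibleUtility L H u ∧ r = expectedRevenue L H F u}

/-- The revenue from selling the goods separately, `SRev(F) = Rev(F₁) + ⋯ + Rev(Fₘ)`. -/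
def SRev {m : ℕ} (L H : Fin m → ℝ) (F : Fin m → Measure ℝ) : ℝ :=
  ∑ j, Rev (m := 1) (fun _ => L j) (fun _ => H j) (fun _ => F j)

/-- The uniform distribution on `[0,1]`. -/
def uniform01 : Measure ℝ := volume.restrict (Icc (0 : ℝ) 1)

instance : IsProbabilityMeasure uniform01 := ⟨by simp [uniform01]⟩

end GoodsMonopoly

end

namespace GoodsMonopoly

open Filter Topology NNReal

/-! The bound is weak duality with an explicit dual solution. For each good `j` take a function z_j
on the cube whose restriction to each line in direction `j` runs from 0 to 1. Then (x_j - z_j) u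
vanishes at both ends of the line, so its `j`-derivative integrates to zero. Summing over `j`
rewrites the revenue as ∫ Σ z_j ∂_j u + ∫ (Σ ∂_j z_j - (m+1)) u. If z_j ≥ 0 and Σ ∂_j z_j ≤ m+1,
then u ≥ 0 and ∂_j u ≤ 1 bound this by ∫ Σ z_j.

The choice is z_j = `ramp (dualSlope j x) (x j)` with slope (m+1)/k, where k is one plus the number
of other goods above the threshold 1/(m+1). As k ≤ m, this ramp rises only where x_j itself exceeds
the threshold. If K goods are above it, each contributes slope at most (m+1)/K, so the total is at
most m+1 (`sum_rampSlope_le`). On a line the ramp integrates to k/(2(m+1)), and k has mean 1 +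
(m-1)m/(m+1), which gives the stated bound.

The integrations by parts need regularity: convexity and the a.e. gradient bound make u Lipschitz
inside the cube, so u may be replaced by a global Lipschitz extension. Mechanisms reduce to feasible
utilities because the truthful utility is convex with gradient equal to the allocation a.e. For one
good the bound is 1/4, attained by the posted price 1/2. -/

/-! ### Regularity of feasible utilities. -/

theorem _root_.ConvexOn.add_hasFDerivAt_le {E : Type*} [NormedAddCommGroup E] [NormedSpace ℝ E]
    {s : Set E} {f : E → ℝ} {D : E →L[ℝ] ℝ} {p y : E} (hf : ConvexOn ℝ s f) (hp : p ∈ s)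
    (hy : y ∈ s) (hD : HasFDerivAt f D p) : f p + D (y - p) ≤ f y := by
  have h1 := (hD.hasLineDerivAt (y - p)).tendsto_slope_zero_right
  have h2 : D (y - p) ≤ f y - f p := by
    refine le_of_tendsto h1 ?_
    have : Ioo (0 : ℝ) 1 ∈ 𝓝[>] (0 : ℝ) := Ioo_mem_nhdsGT one_pos
    filter_upwards [this] with t ht
    have h3 := hf.2 hp hy (sub_nonneg.2 ht.2.le) ht.1.le (by ring)
    have h4 : (1 - t) • p + t • y = p + t • (y - p) := by module
    rw [h4] at h3
    simp only [smul_eq_mul] at h3 ⊢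
    rw [inv_mul_le_iff₀ ht.1]
    linarith
  linarith

/-- A convex function is locally Lipschitz on an open set, so Rademacher's theorem applies near each
point, and a locally null set is null. -/
theorem _root_.ConvexOn.ae_differentiableAt {m : ℕ} {s : Set (Fin m → ℝ)} (hs : IsOpen s)
    {f : (Fin m → ℝ) → ℝ} (hf : ConvexOn ℝ s f) :
    ∀ᵐ x, x ∈ s → DifferentiableAt ℝ f x := by
  have hl := hf.locallyLipschitzOn hs
  rw [← ae_restrict_iff' hs.measurableSet]
  have key : ∀ x ∈ s, ∃ t ∈ 𝓝[s] x, volume ({x | ¬ DifferentiableAt ℝ f x} ∩ t) = 0 := by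
    intro x hx
    obtain ⟨K, t, ht, hK⟩ := hl hx
    rw [hs.nhdsWithin_eq hx] at ht ⊢
    refine ⟨interior t, interior_mem_nhds.2 ht, ?_⟩
    have h := (hK.mono interior_subset).ae_differentiableWithinAt_of_mem (μ := volume)
    rw [ae_iff] at h
    refine measure_mono_null ?_ h
    rintro y ⟨hy, hyt⟩ h'
    exact hy ((h' hyt).differentiableAt (isOpen_interior.mem_nhds hyt))
  rw [ae_iff, Measure.restrict_apply₀']
  · refine measure_null_of_locally_null _ fun x hx => ?_
    obtain ⟨t, ht, h0⟩ := key x hx.2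
    rw [hs.nhdsWithin_eq hx.2] at ht
    exact ⟨_, inter_mem_nhdsWithin _ ht, measure_mono_null (by gcongr; exact inter_subset_left) h0⟩
  · exact hs.measurableSet.nullMeasurableSet

theorem interior_unitCube {m : ℕ} :
    interior (Icc (0 : Fin m → ℝ) 1) = univ.pi fun _ => Ioo (0 : ℝ) 1 := by
  rw [← pi_univ_Icc, interior_pi_set finite_univ]
  simp

theorem fderiv_apply_eq_sum {m : ℕ} {u : (Fin m → ℝ) → ℝ} {x : Fin m → ℝ}
    (h : DifferentiableAt ℝ u x) (v : Fin m → ℝ) :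
    fderiv ℝ u x v = ∑ j, v j * partialDeriv u j x := by
  conv_lhs => rw [← Finset.univ_sum_single v, map_sum]
  refine Finset.sum_congr rfl fun j _ => ?_
  rw [partialDeriv, h.lineDeriv_eq_fderiv, ← smul_eq_mul, ← map_smul, ← Pi.single_smul]
  simp

/-- An a.e. gradient bound alone would not suffice. Convexity supplies a supporting hyperplane at
each point of differentiability, and such points are dense. The constant is `m` because the distance
is the sup distance. -/
theorem IsFeasibleUtility.lipschitzOnWith {m : ℕ} {u : (Fin m → ℝ) → ℝ}
    (hu : IsFeasibleUtility 0 1 u) :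
    LipschitzOnWith (m : ℝ≥0) u (interior (Icc 0 1)) := by
  set s := interior (Icc (0 : Fin m → ℝ) 1) with hs
  have hso : IsOpen s := isOpen_interior
  have hc : ConvexOn ℝ s u := hu.convex.subset interior_subset hu.convex.1.interior
  have hae : ∀ᵐ x, x ∈ s → DifferentiableAt ℝ u x ∧ ∀ j, partialDeriv u j x ∈ Icc (0 : ℝ) 1 := by
    have h2 := ae_all_iff.2 hu.deriv_mem
    rw [ae_restrict_iff' measurableSet_Icc] at h2
    filter_upwards [hc.ae_differentiableAt hso, h2] with x h1 h2 hx
    exact ⟨h1 hx, h2 (interior_subset hx)⟩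
  have hcont : ContinuousOn u s := hu.convex.continuousOn_interior
  have key : ∀ y ∈ s, ∀ p ∈ s, u p - u y ≤ m * dist p y := by
    intro y hy p hp
    by_contra! hlt
    -- The violation is an open condition at `p`, so it persists at a nearby `q` where the gradient
    -- exists and is bounded; the tangent inequality there contradicts it.
    have hcp : ContinuousAt (fun q => u q - u y - m * dist q y) p := by
      have := hcont.continuousAt (hso.mem_nhds hp)
      fun_prop
    have hps : ∀ᶠ q in 𝓝 p, q ∈ s := hso.mem_nhds hp
    have hev : ∀ᶠ q in 𝓝 p, q ∈ s ∧ 0 < u q - u y - m * dist q y :=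
      hps.and (hcp.eventually (lt_mem_nhds (by linarith)))
    have hfr : ∃ᶠ q in 𝓝 p, q ∈ s → DifferentiableAt ℝ u q ∧
        ∀ j, partialDeriv u j q ∈ Icc (0 : ℝ) 1 := by
      have := Measure.dense_of_ae hae
      exact mem_closure_iff_frequently.1 (this p)
    obtain ⟨q, hq1, hqs, hq2⟩ := (hfr.and_eventually hev).exists
    obtain ⟨hd, hq1⟩ := hq1 hqs
    have h3 := hc.add_hasFDerivAt_le hqs hy hd.hasFDerivAt
    rw [fderiv_apply_eq_sum hd] at h3
    have h4 : -(m * dist q y) ≤ ∑ j, (y - q) j * partialDeriv u j q := by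
      have : ∑ _j : Fin m, -dist q y ≤ ∑ j, (y - q) j * partialDeriv u j q := by
        refine Finset.sum_le_sum fun j _ => ?_
        have h5 : |(y - q) j| ≤ dist q y := by
          rw [dist_comm, dist_eq_norm]; exact norm_le_pi_norm (y - q) j
        have h6 := (abs_le.1 h5).1
        have h7 := dist_nonneg (x := q) (y := y)
        nlinarith [(hq1 j).1, (hq1 j).2, mul_nonneg (by linarith : 0 ≤ (y - q) j + dist q y) (hq1 j).1,
          mul_nonneg h7 (sub_nonneg.2 (hq1 j).2)]
      simpa using this
    linarith
  refine LipschitzOnWith.of_dist_le_mul fun x hx y hy => ?_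
  rw [Real.dist_eq, abs_le]
  have h1 := key y hy x hx
  have h2 := key x hx y hy
  rw [dist_comm] at h2
  simp only [NNReal.coe_natCast]
  constructor <;> linarith

/-! ### One-dimensional calculus of ramps. -/

/-- The ramp of slope `s` that vanishes up to `1 - 1 / s` and reaches `1` at `1`. -/
noncomputable def ramp (s t : ℝ) : ℝ := max 0 (1 - s * (1 - t))

theorem lipschitzWith_ramp {s : ℝ} (hs : 0 ≤ s) : LipschitzWith ⟨s, hs⟩ (ramp s) := by
  have : LipschitzWith ⟨s, hs⟩ fun t : ℝ => 1 - s * (1 - t) := by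
    refine LipschitzWith.of_dist_le_mul fun x y => ?_
    rw [Real.dist_eq, Real.dist_eq, show 1 - s * (1 - x) - (1 - s * (1 - y)) = s * (x - y) by ring,
      abs_mul, abs_of_nonneg hs]
    rfl
  exact this.const_max 0

/-- The slope of `ramp s`. -/
noncomputable def rampSlope (s t : ℝ) : ℝ := if 1 - 1 / s < t then s else 0

theorem hasDerivAt_ramp {s t : ℝ} (hs : 0 < s) (ht : t ≠ 1 - 1 / s) :
    HasDerivAt (ramp s) (rampSlope s t) t := by
  have hlin : ∀ r, 1 - s * (1 - r) = s * (r - (1 - 1 / s)) := by intro r; field_simp; ring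
  rcases lt_or_gt_of_ne ht with h | h
  · rw [rampSlope, if_neg (not_lt.2 h.le)]
    refine (hasDerivAt_const t (0 : ℝ)).congr_of_eventuallyEq ?_
    filter_upwards [gt_mem_nhds h] with r hr
    rw [ramp, hlin, max_eq_left]
    nlinarith
  · rw [rampSlope, if_pos h]
    have : HasDerivAt (fun r : ℝ => s * (r - (1 - 1 / s))) s t := by
      simpa using ((hasDerivAt_id t).sub_const (1 - 1 / s)).const_mul s
    refine this.congr_of_eventuallyEq ?_
    filter_upwards [lt_mem_nhds h] with r hr
    rw [ramp, hlin, max_eq_right]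
    nlinarith

theorem ramp_zero {s : ℝ} (hs : 1 ≤ s) : ramp s 0 = 0 := by
  rw [ramp, max_eq_left]; linarith

theorem ramp_one (s : ℝ) : ramp s 1 = 1 := by simp [ramp]

theorem integral_uniform01 (f : ℝ → ℝ) : ∫ t, f t ∂uniform01 = ∫ t in (0 : ℝ)..1, f t := by
  rw [uniform01, integral_Icc_eq_integral_Ioc, intervalIntegral.integral_of_le zero_le_one]

theorem integral_ramp {s : ℝ} (hs : 1 ≤ s) : ∫ t, ramp s t ∂uniform01 = 1 / (2 * s) := by
  have hs0 : 0 < s := by linarith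
  rw [integral_uniform01]
  have hac := ((lipschitzWith_ramp hs0.le).lipschitzOnWith
    (s := uIcc 0 1)).absolutelyContinuousOnInterval
  -- Apply the fundamental theorem of calculus to the square of the ramp: its derivative is `2 * s *
  -- ramp s` a.e., and the square rises from 0 to 1.
  have h := hac.integral_deriv_mul_eq_sub hac
  rw [ramp_zero hs, ramp_one] at h
  have h2 : ∫ t in (0 : ℝ)..1, (deriv (ramp s) t * ramp s t + ramp s t * deriv (ramp s) t)
      = ∫ t in (0 : ℝ)..1, 2 * s * ramp s t := by
    refine intervalIntegral.integral_congr_ae ?_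
    filter_upwards [compl_mem_ae_iff.2 (measure_singleton (1 - 1 / s))] with t ht _
    rw [(hasDerivAt_ramp hs0 ht).deriv, rampSlope]
    split_ifs with h
    · ring
    · have : ramp s t = 0 := by
        rw [ramp, max_eq_left]
        have : 1 - s * (1 - t) = s * (t - (1 - 1 / s)) := by field_simp; ring
        rw [this]; nlinarith
      rw [this]; ring
  rw [h2, intervalIntegral.integral_const_mul] at h
  field_simp
  linarith

/-- The integrand is a.e. the derivative of `(t - ramp s t) * h t`, and the first factor vanishes at
0 and at 1; at 0 this uses `1 ≤ s`. -/
theorem integral_ramp_by_parts {s : ℝ} (hs : 1 ≤ s) {K : ℝ≥0} {h : ℝ → ℝ} (hh : LipschitzWith K h) :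
    ∫ t, (t * deriv h t + h t - rampSlope s t * h t - ramp s t * deriv h t) ∂uniform01 = 0 := by
  have hs0 : 0 < s := by linarith
  rw [integral_uniform01]
  have hid : LipschitzWith 1 fun t : ℝ => t := LipschitzWith.id
  have hac : AbsolutelyContinuousOnInterval (fun t => t - ramp s t) 0 1 :=
    ((hid.sub (lipschitzWith_ramp hs0.le)).lipschitzOnWith
      (s := uIcc 0 1)).absolutelyContinuousOnInterval
  have h1 := hac.integral_deriv_mul_eq_sub
    (hh.lipschitzOnWith (s := uIcc 0 1)).absolutelyContinuousOnInterval
  simp only [ramp_zero hs, ramp_one, sub_self, zero_mul] at h1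
  refine Eq.trans ?_ h1
  refine intervalIntegral.integral_congr_ae ?_
  filter_upwards [compl_mem_ae_iff.2 (measure_singleton (1 - 1 / s))] with t ht _
  have hd : HasDerivAt (fun t => t - ramp s t) (1 - rampSlope s t) t :=
    (hasDerivAt_id' t).sub (hasDerivAt_ramp hs0 ht)
  rw [hd.deriv]
  ring

/-! ### The uniform cube and integration along coordinate lines. -/

/-- The uniform distribution on the unit cube. -/
noncomputable abbrev uniformCube (m : ℕ) : Measure (Fin m → ℝ) := Measure.pi fun _ => uniform01

theorem uniformCube_eq (m : ℕ) :
    uniformCube m = (volume : Measure (Fin m → ℝ)).restrict (Icc 0 1) := by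
  rw [uniformCube, ← pi_univ_Icc, volume_pi, Measure.restrict_pi_pi]
  rfl

theorem uniformCube_restrict (m : ℕ) : (uniformCube m).restrict (Icc 0 1) = uniformCube m := by
  rw [uniformCube_eq, Measure.restrict_restrict measurableSet_Icc, inter_self]

theorem ae_mem_interior (m : ℕ) : ∀ᵐ x ∂uniformCube m, x ∈ interior (Icc (0 : Fin m → ℝ) 1) := by
  have h : (univ.pi fun j => Ioo ((0 : Fin m → ℝ) j) ((1 : Fin m → ℝ) j) : Set (Fin m → ℝ))
      =ᵐ[volume] Icc 0 1 := Measure.univ_pi_Ioo_ae_eq_Icc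
  rw [uniformCube_eq, interior_unitCube, ← Measure.restrict_congr_set h]
  exact ae_restrict_mem (MeasurableSet.univ_pi fun _ => measurableSet_Ioo)

theorem ae_mem_cube (m : ℕ) : ∀ᵐ x ∂uniformCube m, x ∈ Icc (0 : Fin m → ℝ) 1 :=
  (ae_mem_interior m).mono fun _ h => interior_subset h

theorem integral_eq_zero_of_update {m : ℕ} (j : Fin m) {F : (Fin m → ℝ) → ℝ}
    (hF : Integrable F (uniformCube m))
    (h : ∀ x, ∫ t, F (Function.update x j t) ∂uniform01 = 0) :
    ∫ x, F x ∂uniformCube m = 0 := by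
  cases m with
  | zero => exact j.elim0
  | succ n =>
    have hmp := (measurePreserving_piFinSuccAbove (fun _ : Fin (n + 1) => uniform01) j).symm
    rw [← hmp.integral_comp', integral_prod_symm]
    · refine integral_eq_zero_of_ae (.of_forall fun y => ?_)
      -- The inserted value 0 is immaterial, since the update overwrites coordinate `j`.
      refine Eq.trans ?_ (h (j.insertNth 0 y))
      simp [MeasurableEquiv.piFinSuccAbove_symm_apply, Fin.insertNthEquiv]
    · exact (hmp.integrable_comp_emb (MeasurableEquiv.measurableEmbedding _)).2 hF

/-! ### The dual variables: slope constraint and total mass. -/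

/-- One plus the number of goods other than `j` whose valuation exceeds `1 / (m + 1)`. -/
noncomputable def activeCount {m : ℕ} (j : Fin m) (x : Fin m → ℝ) : ℝ :=
  1 + ∑ i ∈ Finset.univ.erase j, if 1 / ((m : ℝ) + 1) < x i then 1 else 0

/-- Since good `j` is not counted, the dual slope is constant on lines in direction `j`, so the
one-dimensional ramp identities apply there. -/
theorem activeCount_update {m : ℕ} (j : Fin m) (x : Fin m → ℝ) (t : ℝ) :
    activeCount j (Function.update x j t) = activeCount j x := by
  unfold activeCount
  congr 1
  refine Finset.sum_congr rfl fun i hi => ?_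
  rw [Function.update_of_ne (Finset.ne_of_mem_erase hi)]

theorem one_le_activeCount {m : ℕ} (j : Fin m) (x : Fin m → ℝ) : 1 ≤ activeCount j x := by
  rw [activeCount, le_add_iff_nonneg_right]
  exact Finset.sum_nonneg fun i _ => by split_ifs <;> norm_num

theorem activeCount_le {m : ℕ} (j : Fin m) (x : Fin m → ℝ) : activeCount j x ≤ m := by
  have h : ∑ i ∈ Finset.univ.erase j, (if 1 / ((m : ℝ) + 1) < x i then (1 : ℝ) else 0)
      ≤ ∑ i ∈ Finset.univ.erase j, (1 : ℝ) :=
    Finset.sum_le_sum fun i _ => by split_ifs <;> norm_num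
  rw [Finset.sum_const, Finset.card_erase_of_mem (Finset.mem_univ j), Finset.card_univ,
    Fintype.card_fin, nsmul_eq_mul, mul_one, Nat.cast_sub (by have := j.2; omega)] at h
  rw [activeCount]
  push_cast at h
  linarith

theorem measurable_activeCount {m : ℕ} (j : Fin m) : Measurable (activeCount j) := by
  unfold activeCount
  refine measurable_const.add (Finset.measurable_sum _ fun i _ => ?_)
  exact Measurable.ite (measurableSet_lt measurable_const (measurable_pi_apply i))
    measurable_const measurable_const

/-- The slope of the dual variable of good `j` at `x`. -/
noncomputable def dualSlope {m : ℕ} (j : Fin m) (x : Fin m → ℝ) : ℝ :=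
  ((m : ℝ) + 1) / activeCount j x

theorem one_le_dualSlope {m : ℕ} (j : Fin m) (x : Fin m → ℝ) : 1 ≤ dualSlope j x := by
  rw [dualSlope, le_div_iff₀ (by linarith [one_le_activeCount j x])]
  linarith [activeCount_le j x]

theorem dualSlope_le {m : ℕ} (j : Fin m) (x : Fin m → ℝ) : dualSlope j x ≤ m + 1 :=
  div_le_self (by positivity) (one_le_activeCount j x)

theorem measurable_dualSlope {m : ℕ} (j : Fin m) : Measurable (dualSlope j) :=
  measurable_const.div (measurable_activeCount j)

theorem measurable_rampSlope {m : ℕ} (j : Fin m) :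
    Measurable fun x : Fin m → ℝ => rampSlope (dualSlope j x) (x j) := by
  have := measurable_dualSlope j
  refine Measurable.ite (measurableSet_lt ?_ (measurable_pi_apply j)) this measurable_const
  fun_prop

theorem measurable_ramp {m : ℕ} (j : Fin m) :
    Measurable fun x : Fin m → ℝ => ramp (dualSlope j x) (x j) := by
  have := measurable_dualSlope j
  unfold ramp
  fun_prop

/-- Dual feasibility: only the `K` goods above the threshold can have positive slope, and for each
of them the active count is exactly `K`. -/
theorem sum_rampSlope_le {m : ℕ} (x : Fin m → ℝ) :
    ∑ j, rampSlope (dualSlope j x) (x j) ≤ m + 1 := by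
  set K : ℝ := ∑ i, if 1 / ((m : ℝ) + 1) < x i then (1 : ℝ) else 0 with hK
  have hK0 : 0 ≤ K := Finset.sum_nonneg fun i _ => by split_ifs <;> norm_num
  have hm : (0 : ℝ) < m + 1 := by positivity
  have h : ∀ j, rampSlope (dualSlope j x) (x j)
      ≤ (if 1 / ((m : ℝ) + 1) < x j then 1 else 0) * ((m + 1) / K) := by
    intro j
    by_cases hj : 1 / ((m : ℝ) + 1) < x j
    · have : activeCount j x = K := by
        rw [hK, ← Finset.add_sum_erase _ _ (Finset.mem_univ j), if_pos hj, activeCount]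
      rw [if_pos hj, one_mul, dualSlope, this, rampSlope]
      split_ifs
      · exact le_rfl
      · positivity
    -- A good at or below the threshold is on the flat part: its kink is at `1 - activeCount j x /
    -- (m + 1)`, which is at least `1 / (m + 1)`.
    · rw [if_neg hj, zero_mul, rampSlope, if_neg]
      have h1 := activeCount_le j x
      rw [dualSlope, one_div_div]
      have h2 : activeCount j x / (m + 1) ≤ m / (m + 1) := by gcongr
      have h3 : (m : ℝ) / (m + 1) = 1 - 1 / (m + 1) := by field_simp; ring
      linarith
  refine (Finset.sum_le_sum fun j _ => h j).trans ?_
  rw [← Finset.sum_mul, ← hK]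
  rcases hK0.eq_or_lt with h0 | h0
  · rw [← h0, zero_mul]; exact hm.le
  · rw [mul_div_cancel₀ _ h0.ne']

theorem ramp_nonneg (s t : ℝ) : 0 ≤ ramp s t := le_max_left _ _

theorem ramp_le_one {s t : ℝ} (hs : 0 ≤ s) (ht : t ≤ 1) : ramp s t ≤ 1 := by
  refine max_le zero_le_one ?_
  nlinarith

theorem rampSlope_nonneg {s : ℝ} (hs : 0 ≤ s) (t : ℝ) : 0 ≤ rampSlope s t := by
  unfold rampSlope; split_ifs <;> simp [hs]

theorem rampSlope_le {s : ℝ} (hs : 0 ≤ s) (t : ℝ) : rampSlope s t ≤ s := by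
  unfold rampSlope; split_ifs <;> simp [hs]

theorem integrable_of_abs_le {m : ℕ} {F : (Fin m → ℝ) → ℝ} (hF : Measurable F) (C : ℝ)
    (h : ∀ x ∈ Icc (0 : Fin m → ℝ) 1, |F x| ≤ C) : Integrable F (uniformCube m) :=
  Integrable.of_bound hF.aestronglyMeasurable C ((ae_mem_cube m).mono h)

theorem integrable_ramp {m : ℕ} (j : Fin m) :
    Integrable (fun x => ramp (dualSlope j x) (x j)) (uniformCube m) := by
  refine integrable_of_abs_le (measurable_ramp j) 1 fun x hx => ?_
  rw [abs_of_nonneg (ramp_nonneg _ _)]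
  exact ramp_le_one (by linarith [one_le_dualSlope j x]) (hx.2 j)

theorem integrable_activeCount {m : ℕ} (j : Fin m) :
    Integrable (activeCount j) (uniformCube m) := by
  refine integrable_of_abs_le (measurable_activeCount j) m fun x _ => ?_
  rw [abs_of_nonneg (by linarith [one_le_activeCount j x])]
  exact activeCount_le j x

theorem integral_activeCount {m : ℕ} (j : Fin m) :
    ∫ x, activeCount j x ∂uniformCube m = (1 + (m : ℝ) ^ 2) / (m + 1) := by
  have hm : (0 : ℝ) < m + 1 := by positivity
  have hmeas : Measurable fun t : ℝ => if 1 / ((m : ℝ) + 1) < t then (1 : ℝ) else 0 :=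
    Measurable.ite measurableSet_Ioi measurable_const measurable_const
  have hi : ∀ i : Fin m, ∫ x : Fin m → ℝ, (if 1 / ((m : ℝ) + 1) < x i then (1 : ℝ) else 0)
      ∂uniformCube m = m / (m + 1) := by
    intro i
    rw [integral_comp_eval (μ := fun _ : Fin m => uniform01) (i := i)
      (f := fun t : ℝ => if 1 / ((m : ℝ) + 1) < t then (1 : ℝ) else 0)
      hmeas.aestronglyMeasurable]
    have h1 : (fun t : ℝ => if 1 / ((m : ℝ) + 1) < t then (1 : ℝ) else 0)
        = (Ioi (1 / ((m : ℝ) + 1))).indicator 1 := by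
      ext t; simp [indicator]
    have h2 : Ioi (1 / ((m : ℝ) + 1)) ∩ Icc 0 1 = Ioc (1 / ((m : ℝ) + 1)) 1 := by
      ext t
      simp only [mem_inter_iff, mem_Ioi, mem_Icc, mem_Ioc]
      have : 0 < 1 / ((m : ℝ) + 1) := by positivity
      constructor
      · rintro ⟨a, b, c⟩; exact ⟨a, c⟩
      · rintro ⟨a, b⟩; exact ⟨a, by linarith, b⟩
    rw [h1, integral_indicator_one measurableSet_Ioi, uniform01, measureReal_restrict_apply
      measurableSet_Ioi, h2, Real.volume_real_Ioc_of_le]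
    · field_simp; ring
    · rw [div_le_one hm]; linarith [(Nat.cast_nonneg m : (0 : ℝ) ≤ m)]
  have hint : ∀ i : Fin m, Integrable
      (fun x : Fin m → ℝ => if 1 / ((m : ℝ) + 1) < x i then (1 : ℝ) else 0) (uniformCube m) :=
    fun i => integrable_of_abs_le (hmeas.comp (measurable_pi_apply i)) 1
      fun x _ => by split_ifs <;> simp
  unfold activeCount
  rw [integral_add (integrable_const _) (integrable_finsetSum _ fun i _ => hint i),
    integral_finsetSum _ fun i _ => hint i, Finset.sum_congr rfl fun i _ => hi i,
    Finset.sum_const, Finset.card_erase_of_mem (Finset.mem_univ j), Finset.card_univ,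
    Fintype.card_fin, nsmul_eq_mul, Nat.cast_sub (by have := j.2; omega)]
  simp only [integral_const, probReal_univ, one_smul]
  field_simp
  push_cast
  ring

theorem integral_ramp_dualSlope {m : ℕ} (j : Fin m) :
    ∫ x, ramp (dualSlope j x) (x j) ∂uniformCube m
      = (1 + (m : ℝ) ^ 2) / (2 * (1 + (m : ℝ)) ^ 2) := by
  have hm : (0 : ℝ) < m + 1 := by positivity
  have hc := (integrable_activeCount j).div_const (2 * ((m : ℝ) + 1))
  -- On each line the ramp has integral `activeCount j x / (2 * (m + 1))`, so the difference
  -- integrates to zero and only the mean of the count is left.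
  have h := integral_eq_zero_of_update j ((integrable_ramp j).sub hc) fun x => by
    have hk := one_le_activeCount j x
    have hr : Integrable (fun t => ramp (dualSlope j x) t) uniform01 :=
      ((lipschitzWith_ramp (by linarith [one_le_dualSlope j x])).continuous.integrableOn_Icc)
    simp only [Pi.sub_apply, dualSlope, activeCount_update, Function.update_self]
    have hi := integral_ramp (one_le_dualSlope j x)
    rw [dualSlope] at hr hi
    rw [integral_sub hr (integrable_const _), hi]
    simp only [integral_const, probReal_univ, one_smul]
    field_simp
    ring
  simp only [Pi.sub_apply] at h
  rw [integral_sub (integrable_ramp j) hc, integral_div, integral_activeCount] at h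
  rw [sub_eq_zero.1 h]
  field_simp
  ring

/-! ### Weak duality for Lipschitz functions. -/

theorem lipschitzWith_update {m : ℕ} (x : Fin m → ℝ) (j : Fin m) :
    LipschitzWith 1 (Function.update x j) := by
  refine LipschitzWith.of_dist_le_mul fun s t => ?_
  rw [NNReal.coe_one, one_mul, dist_pi_le_iff dist_nonneg]
  intro i
  by_cases h : i = j
  · subst h; simp
  · simp [Function.update_of_ne h]

theorem deriv_comp_update {m : ℕ} (g : (Fin m → ℝ) → ℝ) (x : Fin m → ℝ) (j : Fin m) (t : ℝ) :
    deriv (fun s => g (Function.update x j s)) t = partialDeriv g j (Function.update x j t) := by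
  have h : ∀ r : ℝ, Function.update x j t + r • Pi.single j 1 = Function.update x j (t + r) := by
    intro r
    ext i
    by_cases h : i = j
    · subst h; simp
    · simp [Function.update_of_ne h, Pi.single_eq_of_ne h]
  unfold partialDeriv lineDeriv
  simp_rw [h]
  rw [deriv_comp_const_add (fun s => g (Function.update x j s)) t 0, add_zero]

section Lipschitz

variable {m : ℕ} {K : ℝ≥0} {g : (Fin m → ℝ) → ℝ}

theorem measurable_partialDeriv (hg : LipschitzWith K g) (j : Fin m) :
    Measurable (partialDeriv g j) :=
  measurable_lineDeriv hg.continuous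

theorem exists_abs_le (hg : LipschitzWith K g) : ∃ C, ∀ x ∈ Icc (0 : Fin m → ℝ) 1, |g x| ≤ C := by
  obtain ⟨C, hC⟩ := isCompact_Icc.exists_bound_of_continuousOn hg.continuous.continuousOn
  exact ⟨C, hC⟩

theorem integrable_of_lipschitz (hg : LipschitzWith K g) : Integrable g (uniformCube m) := by
  obtain ⟨C, hC⟩ := exists_abs_le hg
  exact integrable_of_abs_le hg.continuous.measurable C hC

theorem integrable_bounded_mul_partialDeriv (hg : LipschitzWith K g) (j : Fin m)
    {w : (Fin m → ℝ) → ℝ} (hw : Measurable w) {C : ℝ}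
    (hC : ∀ x ∈ Icc (0 : Fin m → ℝ) 1, |w x| ≤ C) :
    Integrable (fun x => w x * partialDeriv g j x) (uniformCube m) := by
  refine integrable_of_abs_le (hw.mul (measurable_partialDeriv hg j))
    (C * (K * ‖(Pi.single j 1 : Fin m → ℝ)‖)) fun x hx => ?_
  rw [abs_mul]
  have h1 : |partialDeriv g j x| ≤ K * ‖(Pi.single j 1 : Fin m → ℝ)‖ :=
    norm_lineDeriv_le_of_lipschitz ℝ hg
  exact mul_le_mul (hC x hx) h1 (abs_nonneg _) ((abs_nonneg _).trans (hC x hx))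

theorem abs_coord_le {x : Fin m → ℝ} (hx : x ∈ Icc (0 : Fin m → ℝ) 1) (j : Fin m) : |x j| ≤ 1 := by
  rw [abs_of_nonneg (hx.1 j)]; exact hx.2 j

theorem integrable_ramp_mul_partialDeriv (hg : LipschitzWith K g) (j : Fin m) :
    Integrable (fun x => ramp (dualSlope j x) (x j) * partialDeriv g j x) (uniformCube m) := by
  refine integrable_bounded_mul_partialDeriv hg j (measurable_ramp j) (C := 1) fun x hx => ?_
  rw [abs_of_nonneg (ramp_nonneg _ _)]
  exact ramp_le_one (by linarith [one_le_dualSlope j x]) (hx.2 j)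

theorem integrable_rampSlope_mul (hg : LipschitzWith K g) (j : Fin m) :
    Integrable (fun x => rampSlope (dualSlope j x) (x j) * g x) (uniformCube m) := by
  obtain ⟨C, hC⟩ := exists_abs_le hg
  refine integrable_of_abs_le ((measurable_rampSlope j).mul hg.continuous.measurable)
    ((m + 1) * C) fun x hx => ?_
  have hs : 0 ≤ dualSlope j x := by linarith [one_le_dualSlope j x]
  rw [abs_mul, abs_of_nonneg (rampSlope_nonneg hs _)]
  exact mul_le_mul ((rampSlope_le hs _).trans (dualSlope_le j x)) (hC x hx) (abs_nonneg _)
    (by positivity)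

theorem integrable_coord_mul_partialDeriv (hg : LipschitzWith K g) (j : Fin m) :
    Integrable (fun x => x j * partialDeriv g j x) (uniformCube m) :=
  integrable_bounded_mul_partialDeriv hg j (measurable_pi_apply j) fun _ hx => abs_coord_le hx j

theorem integrable_inducedPayment (hg : LipschitzWith K g) :
    Integrable (inducedPayment g) (uniformCube m) := by
  refine Integrable.sub (integrable_finsetSum _ fun j _ => ?_) (integrable_of_lipschitz hg)
  simpa only [mul_comm] using integrable_coord_mul_partialDeriv hg j

/-- The part of the revenue of good `j` that integrates to zero on every line in direction `j`. -/
noncomputable def lineDefect (g : (Fin m → ℝ) → ℝ) (j : Fin m) (x : Fin m → ℝ) : ℝ :=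
  x j * partialDeriv g j x + g x - rampSlope (dualSlope j x) (x j) * g x
    - ramp (dualSlope j x) (x j) * partialDeriv g j x

theorem integrable_lineDefect (hg : LipschitzWith K g) (j : Fin m) :
    Integrable (lineDefect g j) (uniformCube m) :=
  (((integrable_coord_mul_partialDeriv hg j).add (integrable_of_lipschitz hg)).sub
    (integrable_rampSlope_mul hg j)).sub (integrable_ramp_mul_partialDeriv hg j)

theorem integral_lineDefect (hg : LipschitzWith K g) (j : Fin m) :
    ∫ x, lineDefect g j x ∂uniformCube m = 0 := by
  refine integral_eq_zero_of_update j (integrable_lineDefect hg j) fun x => ?_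
  have h := integral_ramp_by_parts (one_le_dualSlope j x) (hg.comp (lipschitzWith_update x j))
  refine Eq.trans (integral_congr_ae (.of_forall fun t => ?_)) h
  simp only [lineDefect, dualSlope, activeCount_update, Function.update_self, Function.comp_def,
    deriv_comp_update]

theorem integral_inducedPayment_le (hg : LipschitzWith K g)
    (h0 : ∀ᵐ x ∂uniformCube m, 0 ≤ g x)
    (hd : ∀ j, ∀ᵐ x ∂uniformCube m, partialDeriv g j x ∈ Icc (0 : ℝ) 1) :
    ∫ x, inducedPayment g x ∂uniformCube m
      ≤ m * (1 + (m : ℝ) ^ 2) / (2 * (1 + (m : ℝ)) ^ 2) := by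
  have hD : Integrable (fun x => ∑ j, lineDefect g j x) (uniformCube m) :=
    integrable_finsetSum _ fun j _ => integrable_lineDefect hg j
  have hD0 : ∫ x, ∑ j, lineDefect g j x ∂uniformCube m = 0 := by
    rw [integral_finsetSum _ fun j _ => integrable_lineDefect hg j]
    exact Finset.sum_eq_zero fun j _ => integral_lineDefect hg j
  have hZ : Integrable (fun x => ∑ j, ramp (dualSlope j x) (x j)) (uniformCube m) :=
    integrable_finsetSum _ fun j _ => integrable_ramp j
  have hle : ∫ x, (inducedPayment g x - ∑ j, lineDefect g j x) ∂uniformCube m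
      ≤ ∫ x, ∑ j, ramp (dualSlope j x) (x j) ∂uniformCube m := by
    refine integral_mono_ae ((integrable_inducedPayment hg).sub hD) hZ ?_
    filter_upwards [h0, ae_all_iff.2 hd] with x hx0 hxd
    -- Each of the `m` defects contributes one `g`, and the payment another; hence the `m + 1`.
    have h1 : inducedPayment g x - ∑ j, lineDefect g j x
        = ∑ j, ramp (dualSlope j x) (x j) * partialDeriv g j x
          + (∑ j, rampSlope (dualSlope j x) (x j) - (m + 1)) * g x := by
      simp only [inducedPayment, lineDefect, Finset.sum_sub_distrib, Finset.sum_add_distrib,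
        Finset.sum_const, Finset.card_univ, Fintype.card_fin, nsmul_eq_mul, sub_mul,
        Finset.sum_mul, mul_comm (x _)]
      ring
    have h2 : ∑ j, ramp (dualSlope j x) (x j) * partialDeriv g j x
        ≤ ∑ j, ramp (dualSlope j x) (x j) :=
      Finset.sum_le_sum fun j _ => mul_le_of_le_one_right (ramp_nonneg _ _) (hxd j).2
    have h3 := mul_nonneg (sub_nonneg.2 (sum_rampSlope_le x)) hx0
    change inducedPayment g x - ∑ j, lineDefect g j x ≤ _
    rw [h1]
    linarith
  rw [integral_sub (integrable_inducedPayment hg) hD, hD0, sub_zero,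
    integral_finsetSum _ fun j _ => integrable_ramp j,
    Finset.sum_congr rfl fun j _ => integral_ramp_dualSlope j, Finset.sum_const,
    Finset.card_univ, Fintype.card_fin, nsmul_eq_mul, ← mul_div_assoc] at hle
  exact hle

end Lipschitz

/-! ### The bound for feasible utilities. -/

/-- Agreement near almost every point, not merely at it, carries partial derivatives over. The
boundary, where `u` may jump, is null. -/
theorem IsFeasibleUtility.exists_lipschitz_extension {m : ℕ} {u : (Fin m → ℝ) → ℝ}
    (hu : IsFeasibleUtility 0 1 u) :
    ∃ g : (Fin m → ℝ) → ℝ, LipschitzWith (m : ℝ≥0) g ∧ ∀ᵐ x ∂uniformCube m,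
      u =ᶠ[𝓝 x] g ∧ DifferentiableAt ℝ g x := by
  obtain ⟨g, hg, hgu⟩ := hu.lipschitzOnWith.extend_real
  refine ⟨g, hg, ?_⟩
  have h : ∀ᵐ x ∂uniformCube m, DifferentiableAt ℝ g x := by
    rw [uniformCube_eq]
    exact ae_restrict_of_ae hg.ae_differentiableAt
  filter_upwards [h, ae_mem_interior m] with x hx hxi
  exact ⟨hgu.eventuallyEq_of_mem (isOpen_interior.mem_nhds hxi), hx⟩

theorem IsFeasibleUtility.integrable_and_integral_le {m : ℕ} {u : (Fin m → ℝ) → ℝ}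
    (hu : IsFeasibleUtility 0 1 u) :
    Integrable (inducedPayment u) (uniformCube m) ∧ ∫ x, inducedPayment u x ∂uniformCube m
      ≤ m * (1 + (m : ℝ) ^ 2) / (2 * (1 + (m : ℝ)) ^ 2) := by
  obtain ⟨g, hg, hgu⟩ := hu.exists_lipschitz_extension
  have hpd : ∀ᵐ x ∂uniformCube m, ∀ j, partialDeriv u j x = partialDeriv g j x :=
    hgu.mono fun x hx j => hx.1.lineDeriv_eq
  have hpay : inducedPayment u =ᵐ[uniformCube m] inducedPayment g := by
    filter_upwards [hgu, hpd] with x h1 h2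
    simp only [inducedPayment, h2, h1.1.self_of_nhds]
  rw [integral_congr_ae hpay, integrable_congr hpay]
  refine ⟨integrable_inducedPayment hg, integral_inducedPayment_le hg ?_ fun j => ?_⟩
  · filter_upwards [hgu, ae_mem_cube m] with x h1 h2
    rw [← h1.1.self_of_nhds]
    exact hu.nonneg x h2
  · have := hu.deriv_mem j
    rw [← uniformCube_eq] at this
    filter_upwards [this, hpd] with x h1 h2
    rwa [← h2]

theorem expectedRevenue_eq {m : ℕ} (u : (Fin m → ℝ) → ℝ) :
    expectedRevenue 0 1 (fun _ => uniform01) u = ∫ x, inducedPayment u x ∂uniformCube m := by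
  rw [expectedRevenue]
  exact congrArg (fun μ => ∫ x, inducedPayment u x ∂μ) (uniformCube_restrict m)

theorem isFeasibleUtility_zero (m : ℕ) :
    IsFeasibleUtility (0 : Fin m → ℝ) 1 fun _ => 0 where
  nonneg _ _ := le_rfl
  convex := convexOn_const 0 (convex_Icc 0 1)
  deriv_mem j := .of_forall fun x => by simp [partialDeriv, lineDeriv]

theorem Rev_le (m : ℕ) :
    Rev (0 : Fin m → ℝ) 1 (fun _ => uniform01) ≤ m * (1 + (m : ℝ) ^ 2) / (2 * (1 + (m : ℝ)) ^ 2) := by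
  refine csSup_le ⟨_, _, isFeasibleUtility_zero m, rfl⟩ ?_
  rintro _ ⟨u, hu, rfl⟩
  rw [expectedRevenue_eq]
  exact hu.integrable_and_integral_le.2

theorem le_Rev {m : ℕ} {u : (Fin m → ℝ) → ℝ} (hu : IsFeasibleUtility 0 1 u) :
    expectedRevenue 0 1 (fun _ => uniform01) u ≤ Rev (0 : Fin m → ℝ) 1 (fun _ => uniform01) := by
  refine le_csSup ⟨m * (1 + (m : ℝ) ^ 2) / (2 * (1 + (m : ℝ)) ^ 2), ?_⟩ ⟨u, hu, rfl⟩
  rintro _ ⟨v, hv, rfl⟩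
  rw [expectedRevenue_eq]
  exact hv.integrable_and_integral_le.2

/-! ### Reduction of mechanisms to feasible utilities. -/

namespace Mechanism

variable {m : ℕ} {M : Mechanism (0 : Fin m → ℝ) 1}

theorem IncentiveCompatible.subgradient (hM : M.IncentiveCompatible) {x y : Fin m → ℝ}
    (hx : x ∈ Icc (0 : Fin m → ℝ) 1) (hy : y ∈ Icc (0 : Fin m → ℝ) 1) :
    M.utility x x + ∑ j, M.alloc x j * (y j - x j) ≤ M.utility y y := by
  refine le_trans (le_of_eq ?_) (hM y hy x hx)
  simp only [utility, mul_sub, Finset.sum_sub_distrib]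
  ring

/-- Truthful utility is a maximum over reports of functions affine in the valuation; at a convex
combination `z`, compare with both endpoints reporting `z`. -/
theorem IncentiveCompatible.convexOn (hM : M.IncentiveCompatible) :
    ConvexOn ℝ (Icc 0 1) fun x => M.utility x x := by
  refine ⟨convex_Icc 0 1, fun x hx y hy a b ha hb hab => ?_⟩
  set z := a • x + b • y with hz
  have hzm : z ∈ Icc (0 : Fin m → ℝ) 1 := convex_Icc 0 1 hx hy ha hb hab
  have h1 := mul_le_mul_of_nonneg_left (hM x hx z hzm) ha
  have h2 := mul_le_mul_of_nonneg_left (hM y hy z hzm) hb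
  refine le_trans (le_of_eq ?_) (add_le_add h1 h2)
  have h3 : ∑ j, M.alloc z j * z j = a * ∑ j, M.alloc z j * x j + b * ∑ j, M.alloc z j * y j := by
    simp only [Finset.mul_sum, ← Finset.sum_add_distrib]
    refine Finset.sum_congr rfl fun j _ => ?_
    simp only [hz, Pi.add_apply, Pi.smul_apply, smul_eq_mul]
    ring
  simp only [utility, h3]
  linear_combination M.pay z * hab

theorem IncentiveCompatible.partialDeriv_eq (hM : M.IncentiveCompatible) {x : Fin m → ℝ}
    (hx : x ∈ interior (Icc (0 : Fin m → ℝ) 1)) (j : Fin m)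
    (hd : LineDifferentiableAt ℝ (fun x => M.utility x x) x (Pi.single j 1)) :
    partialDeriv (fun x => M.utility x x) j x = M.alloc x j := by
  have h1 := hd.hasLineDerivAt
  unfold HasLineDerivAt at h1
  have h2 := h1.sub ((hasDerivAt_id' (0 : ℝ)).mul_const (M.alloc x j))
  -- The allocation is a subgradient, so utility minus its linear part along the line is minimal at
  -- 0, where the derivative must vanish.
  have hmin : IsLocalMin (fun t : ℝ => M.utility (x + t • Pi.single j 1) (x + t • Pi.single j 1)
      - t * M.alloc x j) 0 := by
    have hc : ContinuousAt (fun t : ℝ => x + t • (Pi.single j 1 : Fin m → ℝ)) 0 := by fun_prop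
    have hev := hc.preimage_mem_nhds (t := Icc (0 : Fin m → ℝ) 1)
      (by simpa using mem_interior_iff_mem_nhds.1 hx)
    filter_upwards [hev] with t ht
    have h3 := hM.subgradient (interior_subset hx) ht
    have h4 : ∑ i, M.alloc x i * ((x + t • (Pi.single j 1 : Fin m → ℝ)) i - x i)
        = t * M.alloc x j := by
      rw [Finset.sum_eq_single j]
      · simp [mul_comm]
      · intro i _ hi; simp [Pi.single_eq_of_ne hi]
      · simp
    rw [h4] at h3
    simp only [zero_smul, add_zero, zero_mul, sub_zero]
    linarith
  have h5 := hmin.hasDerivAt_eq_zero h2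
  rw [one_mul] at h5
  exact sub_eq_zero.1 h5

theorem isFeasibleUtility (hR : M.IndividuallyRational) (hM : M.IncentiveCompatible) :
    IsFeasibleUtility 0 1 fun x => M.utility x x where
  nonneg := hR
  convex := hM.convexOn
  deriv_mem j := by
    rw [← uniformCube_eq]
    filter_upwards [ae_mem_interior m] with x hx
    by_cases hd : LineDifferentiableAt ℝ (fun x => M.utility x x) x (Pi.single j 1)
    · rw [hM.partialDeriv_eq hx j hd]
      exact M.alloc_mem x (interior_subset hx) j
    -- Where the derivative fails to exist, its default value 0 still lies in the unit interval.
    · rw [partialDeriv, lineDeriv_zero_of_not_lineDifferentiableAt hd]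
      simp

theorem pay_ae_eq (hR : M.IndividuallyRational) (hM : M.IncentiveCompatible) :
    M.pay =ᵐ[uniformCube m] inducedPayment fun x => M.utility x x := by
  obtain ⟨g, -, hgu⟩ := (isFeasibleUtility hR hM).exists_lipschitz_extension
  filter_upwards [hgu, ae_mem_interior m] with x h hx
  have hd := h.2.congr_of_eventuallyEq h.1
  simp only [inducedPayment, hM.partialDeriv_eq hx _ hd.lineDifferentiableAt]
  simp [utility]

theorem integrableOn_pay_and_expectedPayment_le (hR : M.IndividuallyRational)
    (hM : M.IncentiveCompatible) :
    IntegrableOn M.pay (Icc 0 1) (uniformCube m) ∧ M.expectedPayment (fun _ => uniform01)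
      ≤ m * (1 + (m : ℝ) ^ 2) / (2 * (1 + (m : ℝ)) ^ 2) := by
  have h := (isFeasibleUtility hR hM).integrable_and_integral_le
  rw [← integral_congr_ae (pay_ae_eq hR hM), ← integrable_congr (pay_ae_eq hR hM)] at h
  refine ⟨h.1.integrableOn, ?_⟩
  rw [expectedPayment]
  refine le_of_eq_of_le ?_ h.2
  exact congrArg (fun μ => ∫ x, M.pay x ∂μ) (uniformCube_restrict m)

end Mechanism

/-! ### The single good and separate selling. -/

/-- The utility of a buyer facing the posted price `1 / 2` for a single good. -/
noncomputable def postedPriceUtility (x : Fin 1 → ℝ) : ℝ := max 0 (x 0 - 1 / 2)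

theorem partialDeriv_postedPriceUtility {x : Fin 1 → ℝ} (hx : x 0 ≠ 1 / 2) (j : Fin 1) :
    partialDeriv postedPriceUtility j x = if 1 / 2 < x 0 then 1 else 0 := by
  obtain rfl := Subsingleton.elim j 0
  have hc : Continuous fun y : Fin 1 → ℝ => y 0 := continuous_apply 0
  rcases lt_or_gt_of_ne hx with h | h
  · have he : postedPriceUtility =ᶠ[𝓝 x] fun _ => 0 := by
      filter_upwards [hc.continuousAt.eventually (gt_mem_nhds h)] with y hy
      exact max_eq_left (by linarith)
    rw [partialDeriv, he.lineDeriv_eq, if_neg h.le.not_gt]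
    simp [lineDeriv]
  · have he : postedPriceUtility =ᶠ[𝓝 x] fun y => y 0 - 1 / 2 := by
      filter_upwards [hc.continuousAt.eventually (lt_mem_nhds h)] with y hy
      exact max_eq_right (by linarith)
    rw [partialDeriv, he.lineDeriv_eq, if_pos h]
    simp [lineDeriv]

theorem ae_ne_half : ∀ᵐ x ∂uniformCube 1, x 0 ≠ 1 / 2 := by
  have h := (measurePreserving_eval (fun _ : Fin 1 => uniform01) 0).quasiMeasurePreserving
  have h2 : ∀ᵐ t ∂uniform01, t ≠ (1 / 2 : ℝ) := by
    rw [uniform01]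
    exact ae_restrict_of_ae (compl_mem_ae_iff.2 (measure_singleton _))
  exact h.ae h2

theorem isFeasibleUtility_postedPriceUtility : IsFeasibleUtility 0 1 postedPriceUtility where
  nonneg _ _ := le_max_left _ _
  convex := by
    refine (convexOn_const 0 (convex_Icc 0 1)).sup
      ⟨convex_Icc 0 1, fun x _ y _ a b _ _ hab => le_of_eq ?_⟩
    simp only [Pi.add_apply, Pi.smul_apply, smul_eq_mul]
    linear_combination (1 / 2) * hab
  deriv_mem j := by
    rw [← uniformCube_eq]
    filter_upwards [ae_ne_half] with x hx
    rw [partialDeriv_postedPriceUtility hx]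
    split_ifs <;> simp

theorem expectedRevenue_postedPriceUtility :
    expectedRevenue 0 1 (fun _ => uniform01) postedPriceUtility = 1 / 4 := by
  rw [expectedRevenue_eq]
  have h : inducedPayment postedPriceUtility =ᵐ[uniformCube 1]
      fun x => (Ioi (1 / 2 : ℝ)).indicator (fun _ => (1 / 2 : ℝ)) (x 0) := by
    filter_upwards [ae_ne_half] with x hx
    simp only [inducedPayment, partialDeriv_postedPriceUtility hx, Finset.univ_unique,
      Fin.default_eq_zero, Finset.sum_singleton, indicator, mem_Ioi, postedPriceUtility]
    split_ifs with h
    · rw [max_eq_right (by linarith)]; ring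
    · rw [max_eq_left (by linarith)]; ring
  have h2 : Ioi (1 / 2 : ℝ) ∩ Icc 0 1 = Ioc (1 / 2) 1 := by
    ext t
    simp only [mem_inter_iff, mem_Ioi, mem_Icc, mem_Ioc]
    constructor
    · rintro ⟨a, b, c⟩; exact ⟨a, c⟩
    · rintro ⟨a, b⟩; exact ⟨a, by linarith, b⟩
  rw [integral_congr_ae h, integral_comp_eval (μ := fun _ : Fin 1 => uniform01) (i := 0)
    (f := (Ioi (1 / 2 : ℝ)).indicator fun _ => (1 / 2 : ℝ))
    (measurable_const.indicator measurableSet_Ioi).aestronglyMeasurable,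
    integral_indicator_const _ measurableSet_Ioi, uniform01,
    measureReal_restrict_apply measurableSet_Ioi, h2, Real.volume_real_Ioc_of_le (by norm_num)]
  norm_num

theorem Rev_one : Rev (0 : Fin 1 → ℝ) 1 (fun _ => uniform01) = 1 / 4 := by
  refine le_antisymm ((Rev_le 1).trans (by norm_num)) ?_
  rw [← expectedRevenue_postedPriceUtility]
  exact le_Rev isFeasibleUtility_postedPriceUtility

theorem SRev_eq (m : ℕ) : SRev (0 : Fin m → ℝ) 1 (fun _ => uniform01) = m / 4 := by
  have h : ∀ j : Fin m, Rev (m := 1) (fun _ => (0 : Fin m → ℝ) j) (fun _ => (1 : Fin m → ℝ) j)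
      (fun _ => uniform01) = 1 / 4 := fun _ => Rev_one
  rw [SRev, Finset.sum_congr rfl fun j _ => h j]
  simp [div_eq_mul_inv]

end GoodsMonopoly

theorem mainTheorem3 (m : ℕ) (hm : 1 ≤ m) :
    -- every truthful, individually rational mechanism
    (∀ M : GoodsMonopoly.Mechanism (0 : Fin m → ℝ) 1,
      M.IndividuallyRational → M.IncentiveCompatible →
        IntegrableOn M.pay (Icc 0 1) (Measure.pi fun _ => GoodsMonopoly.uniform01) ∧
        M.expectedPayment (fun _ => GoodsMonopoly.uniform01)
          ≤ m * (1 + (m : ℝ) ^ 2) / (2 * (1 + (m : ℝ)) ^ 2)) ∧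
    -- every feasible utility function
    (∀ u : (Fin m → ℝ) → ℝ, GoodsMonopoly.IsFeasibleUtility 0 1 u →
      IntegrableOn (GoodsMonopoly.inducedPayment u) (Icc 0 1)
        (Measure.pi fun _ => GoodsMonopoly.uniform01) ∧
      GoodsMonopoly.expectedRevenue 0 1 (fun _ => GoodsMonopoly.uniform01) u
        ≤ m * (1 + (m : ℝ) ^ 2) / (2 * (1 + (m : ℝ)) ^ 2)) ∧
    -- the optimal revenue
    GoodsMonopoly.Rev (0 : Fin m → ℝ) 1 (fun _ => GoodsMonopoly.uniform01)
      ≤ m * (1 + (m : ℝ) ^ 2) / (2 * (1 + (m : ℝ)) ^ 2) ∧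
    -- comparison with selling the goods separately
    GoodsMonopoly.SRev (0 : Fin m → ℝ) 1 (fun _ => GoodsMonopoly.uniform01) = m / 4 ∧
    GoodsMonopoly.Rev (0 : Fin m → ℝ) 1 (fun _ => GoodsMonopoly.uniform01) /
        GoodsMonopoly.SRev (0 : Fin m → ℝ) 1 (fun _ => GoodsMonopoly.uniform01)
      ≤ 2 * (1 + (m : ℝ) ^ 2) / (1 + (m : ℝ)) ^ 2 ∧
    2 * (1 + (m : ℝ) ^ 2) / (1 + (m : ℝ)) ^ 2 < 2 := by
  have hm0 : (0 : ℝ) < m := by exact_mod_cast hm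
  refine ⟨fun M hR hM => M.integrableOn_pay_and_expectedPayment_le hR hM, fun u hu => ?_,
    GoodsMonopoly.Rev_le m, GoodsMonopoly.SRev_eq m, ?_, ?_⟩
  · rw [GoodsMonopoly.expectedRevenue_eq]
    exact ⟨hu.integrable_and_integral_le.1.integrableOn, hu.integrable_and_integral_le.2⟩
  · rw [GoodsMonopoly.SRev_eq, div_le_iff₀ (by positivity)]
    refine (GoodsMonopoly.Rev_le m).trans (le_of_eq ?_)
    field_simp
    ring
  · rw [div_lt_iff₀ (by positivity)]
    nlinarith
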